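/- Let $p$ be a prime, let $r,h$ be positive integers with $r<h$ and $2r\mid h$, and put $q=p^h$. Let $a,b,c\in\mathbb F_{p^{2r}}\subseteq\mathbb F_q$ be nonzero with $c\neq -a/b$, and suppose that $$a\,c^{p^r}=-b,\qquad a^{p^r+1}=1,\qquad a\,b^{p^r}=-c .$$ Put $n=\frac{q-1}{p^r+1}$ and let $\mathcal F$ be the plane curve $$\mathcal F:\ a x^{n}y^{n}+b x^{n}+c y^{n}=1$$ over $\mathbb F_q$. Let $N_q(\mathcal F)$ be the number of $\mathbb F_q$-rational points of the nonsingular projective model of $\mathcal F$, i.e. the number of places of degree one of its function field $\mathbb F_q(\mathcal F)=\operatorname{Frac}\big(\mathbb F_q[x,y]/(ax^ny^n+bx^n+cy^n-1)\big)$. Then $ax^ny^n+bx^n+cy^n-1$ is irreducible over $\mathbb F_q$ (so that the function field is defined), and $$N_q(\mathcal F)=\left(\frac{q-1}{p^{2r}-1}\right)^{2}N'_{p^{2r}}(\mathcal C)+\big(\delta(c)+\delta(b)+\delta(-c/a)+\delta(-b/a)\big)\,n ,$$ where $N'_{p^{2r}}(\mathcal C)$ is the number of points $(x,y)\in\mathbb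 F_{p^{2r}}\times\mathbb F_{p^{2r}}$ with $xy\ne 0$ on the affine curve $$\mathcal C:\ a x^{p^r-1}y^{p^r-1}+b x^{p^r-1}+c y^{p^r-1}-1=0,$$ and $\delta(d)=1$ if $d\in\mathbb F_{p^{2r}}^{*}$ is a $(p^r-1)$-th power in $\mathbb F_{p^{2r}}$, $\delta(d)=0$ otherwise. -/

import Mathlib

open Polynomial

noncomputable section

/-- `V` is a rational (that is, degree one) place of the field `L` over `F`: a proper valuation
ring of `L` that contains the constants `F` and whose residue field is `F`, in the sense that
every element of `V` is congruent to a constant modulo the maximal ideal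
`{v | V.valuation v < 1}` of `V`. -/
def IsRationalPlace (F : Type*) {L : Type*} [Field F] [Field L] [Algebra F L]
    (V : ValuationSubring L) : Prop :=
  V ≠ ⊤ ∧ (∀ t : F, algebraMap F L t ∈ V) ∧
    ∀ v ∈ V, ∃ t : F, V.valuation (v - algebraMap F L t) < 1

/-- The number of rational places of `L` over `F`. -/
def numRationalPlaces (F L : Type*) [Field F] [Field L] [Algebra F L] : ℕ :=
  Nat.card {V : ValuationSubring L // IsRationalPlace F V}

/-- The coordinate ring of the affine plane curve `f = 0` (with `f` irreducible) is a domain.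
Here `F[X][X]` is the ring of polynomials in `x` (inner variable) and `y` (outer variable). -/
theorem coordinateRing_isDomain {F : Type*} [Field F] {f : F[X][X]} (hf : Irreducible f) :
    IsDomain (AdjoinRoot f) :=
  AdjoinRoot.isDomain_of_prime hf.prime

/-- The number `N(f)` of `F`-rational points of the irreducible plane curve `f = 0`, counted on its
nonsingular projective model (equivalently, the number of rational branches of the projective
closure): the number of rational places of the function field `F(x, y)`, `f(x, y) = 0`, which is
the fraction field of the coordinate ring `F[x, y] / (f)`. -/
def numRationalPoints {F : Type*} [Field F] (f : F[X][X]) (hf : Irreducible f) : ℕ :=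
  haveI : IsDomain (AdjoinRoot f) := coordinateRing_isDomain hf
  numRationalPlaces F (FractionRing (AdjoinRoot f))

/-- The polynomial `a x ^ n y ^ m + b x ^ n + c y ^ m - 1`. -/
def genFermat {F : Type*} [Field F] (a b c : F) (n m : ℕ) : F[X][X] :=
  C (C a * X ^ n) * X ^ m + C (C b * X ^ n) + C (C c) * X ^ m - 1

/-- The number of affine `K`-rational points `(x, y)` of the curve `f = 0` with `x y ≠ 0`. -/
def numTorusPoints {K : Type*} [Field K] (f : K[X][X]) : ℕ :=
  Nat.card {P : K × K // f.evalEval P.1 P.2 = 0 ∧ P.1 * P.2 ≠ 0}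

open Classical in
/-- `1` if `d` is a `k`-th power in `K`, and `0` otherwise. -/
def powerIndicator {K : Type*} [Field K] (k : ℕ) (d : K) : ℕ :=
  if ∃ t : K, t ^ k = d then 1 else 0

end

/-! Write d = -1. The closure of the curve in P¹ × P¹ is smooth: the partial derivatives are n
x^(n-1) (a y^n + b) and n y^(n-1) (a x^n + c), n is invertible in F, the two brackets cannot vanish
on the curve because ad ≠ bc, and the four corners of P¹ × P¹ are off the curve because a, b, c, d ≠
0. Hence rational places correspond to rational points of this closure
(`IsBilinPowModel.numRationalPlaces_eq`). Irreducibility is Eisenstein's criterion over F[x]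
(`irreducible_bilinPow`).

For the count, put M = (q-1)/(p^(2r)-1), so that n = M(p^r-1). The norm N from F_q to F_(p^(2r)) is
x ↦ x^M, hence x^n = N(x)^(p^r-1). Since N is surjective on units with fibres of size M, torus
points of F lie M² to one over those of C (`numTorusPoints_bilinPow`). Each of the lines x = 0, y =
0, x = ∞, y = ∞ contributes the solutions of some t^n = e with e in the small field, that is δ(e) n
points (`card_pow_eq`). -/

open Polynomial

/-! ### Valuation rings from local rings -/

/-- A Noetherian subring `R` of a field `L` with field of fractions `L`, localised at a prime
ideal generated by two elements one of which is redundant locally, is a valuation ring. -/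
theorem exists_valuationSubring_of_prime {L : Type*} [Field L] (R : Subring L)
    [IsNoetherianRing R] (P : Ideal R) [P.IsPrime]
    (hfrac : ∀ z : L, ∃ a b : R, (b : L) ≠ 0 ∧ z = a / b)
    {s t e d : R} (hP : P = Ideal.span {s, t}) (he : e ∉ P) (hst : e * s = d * t) :
    ∃ V : ValuationSubring L, (∀ x : R, (x : L) ∈ V) ∧
      (∀ x : R, x ∈ P ↔ V.valuation (x : L) < 1) ∧
      ∀ z ∈ V, ∃ a b : R, b ∉ P ∧ z = a / b := by
  set O := (LocalSubring.ofPrime R P).toSubring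
  have hloc : IsLocalization.AtPrime O P := inferInstanceAs
    (IsLocalization.AtPrime (LocalSubring.ofPrime R P).toSubring P)
  have : IsNoetherianRing O := IsLocalization.isNoetherianRing P.primeCompl O inferInstance
  have hmax : IsLocalRing.maximalIdeal O = Ideal.span {algebraMap R O t} := by
    have hmap : P.map (algebraMap R O) = Ideal.span {algebraMap R O s, algebraMap R O t} := by
      rw [← Set.image_pair, ← Ideal.map_span]
      exact congrArg (Ideal.map (algebraMap R O)) hP
    rw [← IsLocalization.AtPrime.map_eq_maximalIdeal P O, hmap]
    apply le_antisymm
    · rw [Ideal.span_le, Set.insert_subset_iff, Set.singleton_subset_iff]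
      refine ⟨?_, Ideal.subset_span rfl⟩
      have hu : IsUnit (algebraMap R O e) :=
        IsLocalization.map_units O (⟨e, he⟩ : P.primeCompl)
      rw [SetLike.mem_coe, Ideal.mem_span_singleton]
      refine (hu.dvd_mul_left).1 ?_
      rw [← map_mul, hst, map_mul]
      exact Dvd.intro_left _ rfl
    · exact Ideal.span_mono (by simp)
  have hprin : (IsLocalRing.maximalIdeal O).IsPrincipal := ⟨_, hmax⟩
  -- A Noetherian local domain with principal maximal ideal is a field or a discrete valuation ring.
  have : ValuationRing O :=
    ((tfae_of_isNoetherianRing_of_isLocalRing_of_isDomain O).out 4 1).1 hprin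
  have hmem : ∀ z : L, z ∈ O ∨ z⁻¹ ∈ O := by
    intro z
    obtain ⟨a, b, hb, rfl⟩ := hfrac z
    by_cases ha : (a : L) = 0
    · left; rw [ha, zero_div]; exact O.zero_mem
    rcases ValuationRing.dvd_total (algebraMap R O a) (algebraMap R O b) with ⟨w, hw⟩ | ⟨w, hw⟩
    · right
      have h := congrArg (Subtype.val) hw
      have h' : (b : L) = a * w := h
      rw [inv_div, h', mul_div_cancel_left₀ _ ha]
      exact w.2
    · left
      have h := congrArg (Subtype.val) hw
      have h' : (a : L) = b * w := h
      rw [h', mul_div_cancel_left₀ _ hb]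
      exact w.2
  refine ⟨⟨O, hmem⟩, fun x => (algebraMap R O x).2, fun x => ?_, fun z hz => ?_⟩
  · have h1 : x ∈ P ↔ algebraMap R O x ∈ IsLocalRing.maximalIdeal O := by
      rw [← IsLocalization.AtPrime.to_map_mem_maximal_iff O P]
    rw [h1]
    exact ValuationSubring.valuation_lt_one_iff (⟨O, hmem⟩ : ValuationSubring L)
      (algebraMap R O x)
  · obtain ⟨a, b, h⟩ := IsLocalization.exists_mk'_eq P.primeCompl (⟨z, hz⟩ : O)
    refine ⟨a, b, b.2, ?_⟩
    have hb : ((b : R) : L) ≠ 0 := by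
      intro h0
      have : (b : R) = 0 := Subtype.ext h0
      exact b.2 (this ▸ P.zero_mem)
    rw [IsLocalization.mk'_eq_iff_eq_mul] at h
    have h' := congrArg Subtype.val h
    rw [eq_div_iff hb]
    exact h'.symm

/-! ### The equation of the curve and its irreducibility -/

/-- The polynomial `a x ^ n y ^ n + b x ^ n + c y ^ n + d`. -/
noncomputable def bilinPow {F : Type*} [Field F] (a b c d : F) (n : ℕ) : F[X][X] :=
  C (C a * X ^ n + C c) * X ^ n + C (C b * X ^ n + C d)

section bilinPow

variable {F : Type*} [Field F] {a b c d : F} {n : ℕ}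

theorem evalEval_bilinPow (a b c d : F) (n : ℕ) (x y : F) :
    (bilinPow a b c d n).evalEval x y = a * x ^ n * y ^ n + b * x ^ n + c * y ^ n + d := by
  simp [bilinPow, evalEval]; ring

theorem genFermat_eq_bilinPow (a b c : F) (n : ℕ) :
    genFermat a b c n n = bilinPow a b c (-1) n := by
  simp only [genFermat, bilinPow, map_add, map_neg, map_one]; ring

/-- Eliminating X^n between the two polynomials leaves the nonzero constant ad - bc. -/
theorem isUnit_of_dvd_bilinPow_coeff (hdet : a * d ≠ b * c) {g : F[X]}
    (h1 : g ∣ C a * X ^ n + C c) (h2 : g ∣ C b * X ^ n + C d) : IsUnit g := by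
  have h : g ∣ C (a * d - b * c) := by
    have := dvd_sub (h2.mul_left (C a)) (h1.mul_left (C b))
    convert this using 1
    simp only [map_sub, map_mul]; ring
  exact isUnit_of_dvd_unit h (isUnit_C.2 (sub_ne_zero.2 hdet).isUnit)

theorem C_mul_X_pow_add_C_ne_zero (ha : a ≠ 0) (hn : 0 < n) : C a * X ^ n + C c ≠ 0 := by
  intro h
  have := congrArg (coeff · n) h
  simp [coeff_C, hn.ne', ha] at this

theorem natDegree_bilinPow (ha : a ≠ 0) (hn : 0 < n) : (bilinPow a b c d n).natDegree = n := by
  unfold bilinPow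
  exact natDegree_add_C.trans (natDegree_C_mul_X_pow n _ (C_mul_X_pow_add_C_ne_zero ha hn))

theorem isPrimitive_bilinPow (hdet : a * d ≠ b * c) (hn : 0 < n) :
    (bilinPow a b c d n).IsPrimitive := by
  intro g hg
  rw [C_dvd_iff_dvd_coeff] at hg
  refine isUnit_of_dvd_bilinPow_coeff (n := n) hdet ?_ ?_
  · simpa [bilinPow, coeff_C, hn.ne', -map_add, -map_mul] using hg n
  · simpa [bilinPow, coeff_C, hn.ne', hn.ne, coeff_X_pow, -map_add, -map_mul] using hg 0

theorem squarefree_C_mul_X_pow_add_C (hb : b ≠ 0) (hd : d ≠ 0) (hn : (n : F) ≠ 0) :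
    Squarefree (C b * X ^ n + C d) := by
  have h : C b * X ^ n + C d = C b * (X ^ n - C (-d / b)) := by
    rw [mul_sub, ← C_mul, mul_div_cancel₀ _ hb, map_neg, sub_neg_eq_add]
  rw [h]
  have hs := (separable_X_pow_sub_C (-d / b) hn (div_ne_zero (neg_ne_zero.2 hd) hb)).squarefree
  have : Associated (X ^ n - C (-d / b)) (C b * (X ^ n - C (-d / b))) :=
    (associated_unit_mul_left _ _ (isUnit_C.2 hb.isUnit)).symm
  exact (this.squarefree_iff).1 hs

/-- Eisenstein in y at an irreducible factor g of b x^n + d: the middle coefficients are zero, g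
does not divide a x^n + c because ad ≠ bc, and g² does not divide b x^n + d because the latter is
squarefree. -/
theorem irreducible_bilinPow (ha : a ≠ 0) (hb : b ≠ 0) (hd : d ≠ 0) (hdet : a * d ≠ b * c)
    (hn : (n : F) ≠ 0) : Irreducible (bilinPow a b c d n) := by
  have hn0 : 0 < n := Nat.pos_of_ne_zero (by rintro rfl; simp at hn)
  have hdeg := natDegree_bilinPow (b := b) (c := c) (d := d) ha hn0
  have hnu : ¬ IsUnit (C b * X ^ n + C d) := by
    rw [isUnit_iff_degree_eq_zero, degree_add_C, degree_C_mul_X_pow n hb]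
    · exact_mod_cast hn0.ne'
    · rw [degree_C_mul_X_pow n hb]; exact_mod_cast hn0
  obtain ⟨g, hg, hgd⟩ := WfDvdMonoid.exists_irreducible_factor hnu
    (C_mul_X_pow_add_C_ne_zero hb hn0)
  have hlc : (bilinPow a b c d n).leadingCoeff = C a * X ^ n + C c := by
    rw [leadingCoeff, hdeg]
    simp [bilinPow, coeff_C, hn0.ne', -map_add, -map_mul]
  have hc0 : (bilinPow a b c d n).coeff 0 = C b * X ^ n + C d := by
    simp [bilinPow, hn0.ne, coeff_X_pow, -map_add, -map_mul]
  refine irreducible_of_eisenstein_criterion (P := Ideal.span {g})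
    ((Ideal.span_singleton_prime hg.ne_zero).2 hg.prime) ?_ ?_ ?_ ?_
    (isPrimitive_bilinPow hdet hn0)
  · rw [hlc, Ideal.mem_span_singleton]
    exact fun h => hg.not_isUnit (isUnit_of_dvd_bilinPow_coeff hdet h hgd)
  · intro m hm
    rw [degree_eq_natDegree (fun h => by rw [h] at hdeg; simp at hdeg; omega), hdeg] at hm
    have hm : m < n := by exact_mod_cast hm
    rw [Ideal.mem_span_singleton]
    rcases Nat.eq_zero_or_pos m with rfl | h0
    · rwa [hc0]
    · have : (bilinPow a b c d n).coeff m = 0 := by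
        simp [bilinPow, hm.ne, coeff_X_pow, coeff_C, h0.ne', -map_add, -map_mul]
      rw [this]; exact dvd_zero _
  · exact natDegree_pos_iff_degree_pos.1 (by rw [hdeg]; exact hn0)
  · rw [hc0, Ideal.span_singleton_pow, Ideal.mem_span_singleton, sq]
    exact fun h => hg.not_isUnit (squarefree_C_mul_X_pow_add_C hb hd hn g h)

end bilinPow

/-! ### Relations between the coordinate functions -/

/-- Evaluation of a bivariate polynomial at a point `(u, v)` with coordinates in an extension. -/
noncomputable def evalPair {F L : Type*} [Field F] [Field L] [Algebra F L] (u v : L) : F[X][X] →+* L :=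
  eval₂RingHom (aeval u : F[X] →ₐ[F] L).toRingHom v

section evalPair

variable {F L : Type*} [Field F] [Field L] [Algebra F L]

@[simp]
theorem evalPair_X (u v : L) : evalPair u v (X : F[X][X]) = v := by
  simp [evalPair]

@[simp]
theorem evalPair_C (u v : L) (g : F[X]) : evalPair u v (C g) = aeval u g := by
  simp [evalPair]

theorem evalPair_bilinPow (u v : L) (a b c d : F) (n : ℕ) :
    evalPair u v (bilinPow a b c d n) = algebraMap F L a * u ^ n * v ^ n +
      algebraMap F L b * u ^ n + algebraMap F L c * v ^ n + algebraMap F L d := by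
  simp only [bilinPow, map_add, map_mul, map_pow, evalPair_X, evalPair_C, aeval_C, aeval_X]
  ring

/-- If `p` is irreducible and primitive over `F[X]`, `u` is transcendental and `p (u, v) = 0`,
then every relation between `u` and `v` is a multiple of `p`. -/
theorem dvd_of_evalPair_eq_zero {u v : L}
    (hu : Transcendental F u) {p g : F[X][X]} (hp : Irreducible p) (hprim : p.IsPrimitive)
    (hp0 : evalPair u v p = 0) (hg0 : evalPair u v g = 0) : p ∣ g := by
  have hinj : Function.Injective (aeval u : F[X] →ₐ[F] L).toRingHom :=
    transcendental_iff_injective.1 hu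
  let K := FractionRing F[X]
  let j : K →+* L := IsFractionRing.lift hinj
  have hj : j.comp (algebraMap F[X] K) = (aeval u : F[X] →ₐ[F] L).toRingHom :=
    RingHom.ext fun x => IsFractionRing.lift_algebraMap hinj x
  have hev : ∀ q : F[X][X], eval₂ j v (q.map (algebraMap F[X] K)) = evalPair u v q := by
    intro q
    rw [eval₂_map, hj]
    rfl
  -- By Gauss's lemma p stays irreducible over F(X). If it did not divide g there, a Bézout relation
  -- between p and g evaluated at v would read 0 = 1.
  have hpK := (hprim.irreducible_iff_irreducible_map_fraction_map (K := K)).1 hp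
  apply hprim.dvd_of_fraction_map_dvd_fraction_map (K := K)
  by_contra hnd
  obtain ⟨r, s, h⟩ := (hpK.coprime_iff_not_dvd).2 hnd
  have := congrArg (eval₂ j v) h
  rw [eval₂_add, eval₂_mul, eval₂_mul, hev, hev, hp0, hg0] at this
  simp at this

end evalPair

/-! ### Centers of rational places -/

section Centers

variable {F L : Type*} [Field F] [Field L] [Algebra F L] {V : ValuationSubring L}

theorem IsRationalPlace.valuation_algebraMap (hV : IsRationalPlace F V) {α : F} (hα : α ≠ 0) :
    V.valuation (algebraMap F L α) = 1 := by
  have h1 := (V.valuation_le_one_iff _).2 (hV.2.1 α)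
  have h2 := (V.valuation_le_one_iff _).2 (hV.2.1 α⁻¹)
  rw [map_inv₀, map_inv₀] at h2
  refine le_antisymm h1 ?_
  have h0 : V.valuation (algebraMap F L α) ≠ 0 := by simpa using hα
  exact (inv_le_one₀ (zero_lt_iff.2 h0)).1 h2

theorem IsRationalPlace.center_unique (hV : IsRationalPlace F V) {z : L} {α β : F}
    (hα : V.valuation (z - algebraMap F L α) < 1) (hβ : V.valuation (z - algebraMap F L β) < 1) :
    α = β := by
  by_contra hne
  have h := hV.valuation_algebraMap (sub_ne_zero.2 hne)
  have h' := Valuation.map_sub_lt V.valuation hβ hα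
  rw [sub_sub_sub_cancel_left, ← map_sub, h] at h'
  exact lt_irrefl _ h'

theorem IsRationalPlace.mem_of_center (hV : IsRationalPlace F V) {z : L} {α : F}
    (hα : V.valuation (z - algebraMap F L α) < 1) : z ∈ V := by
  have := V.add_mem _ _ ((V.valuation_le_one_iff _).1 hα.le) (hV.2.1 α)
  rwa [sub_add_cancel] at this

theorem not_mem_of_valuation_inv_lt_one {z : L} (hz : z ≠ 0) (h : V.valuation z⁻¹ < 1) :
    z ∉ V := by
  intro hmem
  have h1 := (V.valuation_le_one_iff _).2 hmem
  have := mul_lt_one_of_lt_of_le h h1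
  rw [← map_mul, inv_mul_cancel₀ hz, map_one] at this
  exact lt_irrefl _ this

theorem valuation_inv_lt_one_of_not_mem {z : L} (h : z ∉ V) : V.valuation z⁻¹ < 1 := by
  rw [← V.valuation_le_one_iff, not_le] at h
  rw [map_inv₀]
  exact inv_lt_one_of_one_lt₀ h

theorem evalPair_mem (hF : ∀ t : F, algebraMap F L t ∈ V) {u v : L} (hu : u ∈ V) (hv : v ∈ V)
    (g : F[X][X]) : evalPair u v g ∈ V := by
  have h1 : ∀ g : F[X], aeval u g ∈ V := fun g => by
    rw [aeval_eq_sum_range]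
    exact sum_mem fun i _ => by
      rw [Algebra.smul_def]
      exact mul_mem (hF _) (pow_mem hu _)
  rw [evalPair, coe_eval₂RingHom, eval₂_eq_sum_range]
  exact sum_mem fun i _ => mul_mem (h1 _) (pow_mem hv _)

/-- Division by y - β, then by x - α. It shows that the ideal of the point (α, β) is generated by x
- α and y - β. -/
theorem exists_eq_of_evalEval (g : F[X][X]) (α β : F) : ∃ s t : F[X][X],
    g = s * C (X - C α) + t * (X - C (C β)) + C (C (g.evalEval α β)) := by
  obtain ⟨t, ht⟩ := X_sub_C_dvd_sub_C_eval (a := C β) (p := g)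
  obtain ⟨s, hs⟩ := X_sub_C_dvd_sub_C_eval (a := α) (p := g.eval (C β))
  refine ⟨C s, t, ?_⟩
  rw [← C_mul, mul_comm s, ← hs, mul_comm t, ← ht, evalEval]
  simp only [C_sub]; ring

theorem IsRationalPlace.center_evalPair (hV : IsRationalPlace F V) {u v : L} {α β : F}
    (hu : V.valuation (u - algebraMap F L α) < 1) (hv : V.valuation (v - algebraMap F L β) < 1)
    (g : F[X][X]) :
    V.valuation (evalPair u v g - algebraMap F L (g.evalEval α β)) < 1 := by
  obtain ⟨s, t, h⟩ := exists_eq_of_evalEval g α β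
  have hmem := evalPair_mem hV.2.1 (hV.mem_of_center hu) (hV.mem_of_center hv)
  have h' : evalPair u v g - algebraMap F L (g.evalEval α β) =
      evalPair u v s * (u - algebraMap F L α) + evalPair u v t * (v - algebraMap F L β) := by
    have := congrArg (evalPair u v) h
    simp only [map_add, map_mul, map_sub, evalPair_C, evalPair_X, aeval_X, aeval_C] at this
    rw [this]; ring
  rw [h']
  refine Valuation.map_add_lt _ ?_ ?_ <;> rw [mul_comm, map_mul]
  · exact mul_lt_one_of_lt_of_le hu ((V.valuation_le_one_iff _).2 (hmem s))
  · exact mul_lt_one_of_lt_of_le hv ((V.valuation_le_one_iff _).2 (hmem t))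

theorem IsRationalPlace.valuation_evalPair_lt_one (hV : IsRationalPlace F V) {u v : L} {α β : F}
    (hu : V.valuation (u - algebraMap F L α) < 1) (hv : V.valuation (v - algebraMap F L β) < 1)
    {g : F[X][X]} (hg : g.evalEval α β = 0) : V.valuation (evalPair u v g) < 1 := by
  simpa [hg] using hV.center_evalPair hu hv g

theorem IsRationalPlace.evalEval_eq_zero (hV : IsRationalPlace F V) {u v : L} {α β : F}
    (hu : V.valuation (u - algebraMap F L α) < 1) (hv : V.valuation (v - algebraMap F L β) < 1)
    {g : F[X][X]} (hg : V.valuation (evalPair u v g) < 1) : g.evalEval α β = 0 := by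
  refine hV.center_unique (hV.center_evalPair hu hv g) ?_
  simpa using hg

end Centers

/-! ### Smoothness and the places of the curve -/

/-- Nondegeneracy of the coefficients and the exponent of `bilinPow a b c d n`. -/
structure IsNondegenerate {F : Type*} [Field F] (a b c d : F) (n : ℕ) : Prop where
  ha : a ≠ 0
  hb : b ≠ 0
  hc : c ≠ 0
  hd : d ≠ 0
  hdet : a * d ≠ b * c
  hn : (n : F) ≠ 0

/-- `(u, v)` is a generic point of the curve `bilinPow a b c d n = 0` generating `L` over `F`. -/
structure IsBilinPowModel {F L : Type*} [Field F] [Field L] [Algebra F L] (a b c d : F) (n : ℕ)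
    (u v : L) : Prop extends IsNondegenerate a b c d n where
  transcendental : Transcendental F u
  eval_eq_zero : evalPair u v (bilinPow a b c d n) = 0
  adjoin_eq_top : IntermediateField.adjoin F {u, v} = ⊤

namespace IsBilinPowModel

variable {F L : Type*} [Field F] [Field L] [Algebra F L] {a b c d : F} {n : ℕ} {u v : L}

theorem pos (h : IsBilinPowModel a b c d n u v) : 0 < n :=
  Nat.pos_of_ne_zero (by rintro rfl; simpa using h.hn)

theorem left_ne_zero (h : IsBilinPowModel a b c d n u v) : u ≠ 0 := by
  rintro rfl
  exact h.transcendental isAlgebraic_zero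

theorem dvd (h : IsBilinPowModel a b c d n u v) {g : F[X][X]} (hg : evalPair u v g = 0) :
    bilinPow a b c d n ∣ g :=
  dvd_of_evalPair_eq_zero h.transcendental
    (irreducible_bilinPow h.ha h.hb h.hd h.hdet h.hn) (isPrimitive_bilinPow h.hdet h.pos)
    h.eval_eq_zero hg

theorem right_ne_zero (h : IsBilinPowModel a b c d n u v) : v ≠ 0 := by
  rintro rfl
  have h0 := h.eval_eq_zero
  rw [bilinPow, map_add, map_mul, map_pow, evalPair_X, zero_pow h.pos.ne', mul_zero, zero_add,
    evalPair_C] at h0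
  exact C_mul_X_pow_add_C_ne_zero h.hb h.pos (transcendental_iff.1 h.transcendental _ h0)

/-- Change of chart on P¹ × P¹: dividing the equation by u^n permutes the coefficients, so points
with u = ∞ become affine points with first coordinate 0. -/
theorem inv_left (h : IsBilinPowModel a b c d n u v) : IsBilinPowModel c d a b n u⁻¹ v where
  ha := h.hc
  hb := h.hd
  hc := h.ha
  hd := h.hb
  hdet := fun h' => h.hdet (by rw [mul_comm, ← h', mul_comm])
  hn := h.hn
  transcendental := fun h' => h.transcendental (by simpa using h'.inv)
  eval_eq_zero := by
    have h0 := h.eval_eq_zero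
    have hu := pow_ne_zero n h.left_ne_zero
    rw [evalPair_bilinPow] at h0 ⊢
    rw [inv_pow]
    field_simp
    linear_combination h0
  adjoin_eq_top := by
    rw [eq_top_iff, ← h.adjoin_eq_top, IntermediateField.adjoin_le_iff]
    rintro z (rfl | rfl)
    · have h' : z⁻¹ ∈ IntermediateField.adjoin F {z⁻¹, v} :=
        IntermediateField.subset_adjoin F _ (by simp)
      simpa using inv_mem h'
    · exact IntermediateField.subset_adjoin F _ (by simp)

theorem inv_right (h : IsBilinPowModel a b c d n u v) : IsBilinPowModel b a d c n u v⁻¹ where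
  ha := h.hb
  hb := h.ha
  hc := h.hd
  hd := h.hc
  hdet := fun h' => h.hdet h'.symm
  hn := h.hn
  transcendental := h.transcendental
  eval_eq_zero := by
    have h0 := h.eval_eq_zero
    have hv := pow_ne_zero n h.right_ne_zero
    rw [evalPair_bilinPow] at h0 ⊢
    rw [inv_pow]
    field_simp
    linear_combination h0
  adjoin_eq_top := by
    rw [eq_top_iff, ← h.adjoin_eq_top, IntermediateField.adjoin_le_iff]
    rintro z (rfl | rfl)
    · exact IntermediateField.subset_adjoin F _ (by simp)
    · have h' : z⁻¹ ∈ IntermediateField.adjoin F {u, z⁻¹} :=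
        IntermediateField.subset_adjoin F _ (by simp)
      simpa using inv_mem h'

theorem exists_eq_div (h : IsBilinPowModel a b c d n u v) (z : L) : ∃ g k : F[X][X],
    evalPair u v k ≠ 0 ∧ z = evalPair u v g / evalPair u v k := by
  have hz : z ∈ IntermediateField.adjoin F {u, v} := h.adjoin_eq_top ▸ IntermediateField.mem_top
  have key : ∀ x ∈ Algebra.adjoin F {u, v}, ∃ g : F[X][X], evalPair u v g = x := by
    intro x hx
    induction hx using Algebra.adjoin_induction with
    | mem x hx =>
      rcases hx with rfl | rfl
      · exact ⟨C X, by simp⟩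
      · exact ⟨X, by simp⟩
    | algebraMap r => exact ⟨C (C r), by simp⟩
    | add x y _ _ hx hy =>
      obtain ⟨g, rfl⟩ := hx
      obtain ⟨k, rfl⟩ := hy
      exact ⟨g + k, map_add _ _ _⟩
    | mul x y _ _ hx hy =>
      obtain ⟨g, rfl⟩ := hx
      obtain ⟨k, rfl⟩ := hy
      exact ⟨g * k, map_mul _ _ _⟩
  obtain ⟨r, hr, s, hs, rfl⟩ := IntermediateField.mem_adjoin_iff_div.1 hz
  obtain ⟨g, rfl⟩ := key r hr
  obtain ⟨k, rfl⟩ := key s hs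
  by_cases hk : evalPair u v k = 0
  · exact ⟨0, 1, by simp, by simp [hk]⟩
  · exact ⟨g, k, hk, rfl⟩

/-- At a point of a nondegenerate curve, one of the local coordinates is a multiple of the
other. -/
theorem exists_local_relation (h : IsBilinPowModel a b c d n u v) {α β : F}
    (hz : (bilinPow a b c d n).evalEval α β = 0) :
    (∃ e k : F[X][X], e.evalEval α β ≠ 0 ∧
      evalPair u v e * (u - algebraMap F L α) = evalPair u v k * (v - algebraMap F L β)) ∨
    (∃ e k : F[X][X], e.evalEval α β ≠ 0 ∧
      evalPair u v e * (v - algebraMap F L β) = evalPair u v k * (u - algebraMap F L α)) := by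
  rw [evalEval_bilinPow] at hz
  have h0 := h.eval_eq_zero
  rw [evalPair_bilinPow] at h0
  have hzL := congrArg (algebraMap F L) hz
  simp only [map_add, map_mul, map_pow, map_zero] at hzL
  have hpow : ∀ γ : F, ∃ g : F[X], X ^ n - C (γ ^ n) = (X - C γ) * g ∧
      g.eval γ = n * γ ^ (n - 1) := by
    intro γ
    obtain ⟨g, hg⟩ := X_sub_C_dvd_sub_C_eval (a := γ) (p := (X ^ n : F[X]))
    rw [eval_pow, eval_X] at hg
    refine ⟨g, hg, ?_⟩
    have := congrArg (fun q => eval γ (derivative q)) hg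
    simpa [derivative_X_pow, -map_pow] using this.symm
  obtain ⟨g, hg, hgα⟩ := hpow α
  obtain ⟨k, hk, hkβ⟩ := hpow β
  have hgu := congrArg (aeval u) hg
  have hkv := congrArg (aeval v) hk
  simp only [map_sub, map_mul, map_pow, aeval_X, aeval_C] at hgu hkv
  have hkY : evalPair u v (k.map C) = aeval v k := by
    rw [evalPair, coe_eval₂RingHom, eval₂_map, aeval_def]
    congr 1
    ext x
    simp
  -- The difference of the equations at (u, v) and at (α, β) is (a v^n + b)(u^n - α^n) + (a α^n +
  -- c)(v^n - β^n) = 0.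
  have hrel : (algebraMap F L a * v ^ n + algebraMap F L b) * aeval u g *
      (u - algebraMap F L α) = - ((algebraMap F L a * algebraMap F L α ^ n + algebraMap F L c) *
        aeval v k) * (v - algebraMap F L β) := by
    linear_combination (-(algebraMap F L a * v ^ n + algebraMap F L b)) * hgu -
      (algebraMap F L a * algebraMap F L α ^ n + algebraMap F L c) * hkv + h0 - hzL
  have hac : a * α ^ n + c ≠ 0 := fun h1 => h.hdet <| by
    have h2 : b * α ^ n + d = 0 := by linear_combination hz - β ^ n * h1
    linear_combination a * h2 - b * h1
  have hab : a * β ^ n + b ≠ 0 := fun h1 => h.hdet <| by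
    have h2 : c * β ^ n + d = 0 := by linear_combination hz - α ^ n * h1
    linear_combination a * h2 - c * h1
  -- If β = 0 then α ≠ 0, as d ≠ 0, and the factor of u - α takes the value (a β^n + b) n α^(n-1) ≠
  -- 0. Otherwise the factor of v - β takes the value -(a α^n + c) n β^(n-1) ≠ 0.
  by_cases hβ : β = 0
  · have hα : α ≠ 0 := by
      rintro rfl
      rw [hβ, zero_pow h.pos.ne'] at hz
      exact h.hd (by simpa using hz)
    refine Or.inl ⟨(C (C a) * X ^ n + C (C b)) * C g, -(C (C a * C α ^ n + C c) * k.map C), ?_, ?_⟩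
    · simpa [evalEval, hgα] using ⟨hab, h.hn, fun h => absurd h hα⟩
    · simpa [hkY] using hrel
  · refine Or.inr ⟨-(C (C a * C α ^ n + C c) * k.map C), (C (C a) * X ^ n + C (C b)) * C g, ?_, ?_⟩
    · have h1 : (k.map C).evalEval α β = n * β ^ (n - 1) := by rw [evalEval_map_C, hkβ]
      rw [evalEval_neg, evalEval_mul, h1, evalEval_C, neg_ne_zero]
      refine mul_ne_zero (by simpa using hac) (mul_ne_zero h.hn (pow_ne_zero _ hβ))
    · simpa [hkY] using hrel.symm

end IsBilinPowModel

namespace IsBilinPowModel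

variable {F L : Type*} [Field F] [Field L] [Algebra F L] {a b c d : F} {n : ℕ} {u v : L}

/-- The local ring of the curve at a rational point is a valuation ring. -/
theorem exists_valuationSubring (h : IsBilinPowModel a b c d n u v) {α β : F}
    (hz : (bilinPow a b c d n).evalEval α β = 0) :
    ∃ V : ValuationSubring L, (∀ g : F[X][X], evalPair u v g ∈ V) ∧
      (∀ g : F[X][X], g.evalEval α β = 0 ↔ V.valuation (evalPair u v g) < 1) ∧
      ∀ z ∈ V, ∃ g k : F[X][X], k.evalEval α β ≠ 0 ∧ z = evalPair u v g / evalPair u v k := by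
  let φ : F[X][X] →+* (evalPair u v : F[X][X] →+* L).range := (evalPair u v).rangeRestrict
  have hφs : Function.Surjective φ := RingHom.rangeRestrict_surjective _
  have hφ : ∀ g, ((φ g : (evalPair u v : F[X][X] →+* L).range) : L) = evalPair u v g :=
    fun g => rfl
  -- Every relation between u and v is a multiple of the equation, so evaluation at (α, β) descends
  -- to the coordinate ring.
  have hker : RingHom.ker φ ≤ RingHom.ker (evalEvalRingHom α β) := by
    intro g hg
    have h1 : evalPair u v g = 0 := congrArg Subtype.val hg
    obtain ⟨k, rfl⟩ := h.dvd h1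
    rw [RingHom.mem_ker, map_mul, coe_evalEvalRingHom, hz, zero_mul]
  have : IsNoetherianRing (evalPair u v : F[X][X] →+* L).range :=
    isNoetherianRing_of_surjective _ _ φ hφs
  set P := (RingHom.ker (evalEvalRingHom α β)).map φ with hP
  have hker' : (RingHom.ker (evalEvalRingHom α β)).IsPrime := RingHom.ker_isPrime _
  have hPp : P.IsPrime := Ideal.map_isPrime_of_surjective hφs hker
  have hmem : ∀ g, φ g ∈ P ↔ g.evalEval α β = 0 := by
    intro g
    rw [← Ideal.mem_comap, hP, Ideal.comap_map_of_surjective φ hφs, ← RingHom.ker_eq_comap_bot,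
      sup_eq_left.2 hker, RingHom.mem_ker, coe_evalEvalRingHom]
  have hspan : P = Ideal.span {φ (C (X - C α)), φ (X - C (C β))} := by
    apply le_antisymm
    · rw [hP, Ideal.map_le_iff_le_comap]
      intro g hg
      rw [RingHom.mem_ker, coe_evalEvalRingHom] at hg
      obtain ⟨s, t, hst⟩ := exists_eq_of_evalEval g α β
      rw [hg, C_0, C_0, add_zero] at hst
      rw [Ideal.mem_comap, Ideal.mem_span_pair, hst]
      exact ⟨φ s, φ t, by rw [map_add, map_mul, map_mul]⟩
    · rw [Ideal.span_le, Set.insert_subset_iff, Set.singleton_subset_iff, SetLike.mem_coe,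
        SetLike.mem_coe, hmem, hmem]
      constructor <;> simp [evalEval]
  have hfrac : ∀ z : L, ∃ a b : (evalPair u v : F[X][X] →+* L).range,
      (b : L) ≠ 0 ∧ z = a / b := by
    intro z
    obtain ⟨g, k, hk, rfl⟩ := h.exists_eq_div z
    exact ⟨φ g, φ k, hk, rfl⟩
  have hV : ∃ V : ValuationSubring L,
      (∀ x : (evalPair u v : F[X][X] →+* L).range, (x : L) ∈ V) ∧
      (∀ x : (evalPair u v : F[X][X] →+* L).range, x ∈ P ↔ V.valuation (x : L) < 1) ∧
      ∀ z ∈ V, ∃ a b : (evalPair u v : F[X][X] →+* L).range, b ∉ P ∧ z = a / b := by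
    rcases h.exists_local_relation hz with ⟨e, k, he, hek⟩ | ⟨e, k, he, hek⟩
    · refine exists_valuationSubring_of_prime _ P hfrac (e := φ e) (d := φ k) hspan
        (by rwa [hmem]) (Subtype.ext ?_)
      simpa [hφ] using hek
    · refine exists_valuationSubring_of_prime _ P hfrac (e := φ e) (d := φ k)
        (s := φ (X - C (C β))) (t := φ (C (X - C α)))
        (hspan.trans (by rw [Set.pair_comm])) (by rwa [hmem]) (Subtype.ext ?_)
      simpa [hφ] using hek
  obtain ⟨V, hV1, hV2, hV3⟩ := hV
  refine ⟨V, fun g => hV1 (φ g), fun g => by rw [← hmem, hV2, hφ], fun z hz => ?_⟩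
  obtain ⟨x, y, hy, rfl⟩ := hV3 z hz
  obtain ⟨g, rfl⟩ := hφs x
  obtain ⟨k, rfl⟩ := hφs y
  exact ⟨g, k, fun h0 => hy ((hmem k).2 h0), rfl⟩

/-- A smooth rational point is the center of exactly one rational place: its local ring is a
valuation ring V, and any place W with this center dominates V, which forces W = V. -/
theorem exists_place (h : IsBilinPowModel a b c d n u v) {α β : F}
    (hz : (bilinPow a b c d n).evalEval α β = 0) :
    ∃ V : ValuationSubring L, IsRationalPlace F V ∧ V.valuation (u - algebraMap F L α) < 1 ∧
      V.valuation (v - algebraMap F L β) < 1 ∧ ∀ W : ValuationSubring L, IsRationalPlace F W →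
        W.valuation (u - algebraMap F L α) < 1 → W.valuation (v - algebraMap F L β) < 1 →
          W = V := by
  obtain ⟨V, hV1, hV2, hV3⟩ := h.exists_valuationSubring hz
  have hu : V.valuation (u - algebraMap F L α) < 1 := by
    have := (hV2 (C (X - C α))).1 (by simp [evalEval])
    simpa using this
  have hv : V.valuation (v - algebraMap F L β) < 1 := by
    have := (hV2 (X - C (C β))).1 (by simp)
    simpa using this
  have hVF : ∀ t : F, algebraMap F L t ∈ V := fun t => by simpa using hV1 (C (C t))
  have hval : ∀ k : F[X][X], k.evalEval α β ≠ 0 → V.valuation (evalPair u v k) = 1 :=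
    fun k hk => le_antisymm ((V.valuation_le_one_iff _).2 (hV1 k))
      (not_lt.1 fun h' => hk ((hV2 k).2 h'))
  have hrat : IsRationalPlace F V := by
    refine ⟨?_, hVF, fun z hz => ?_⟩
    · rintro rfl
      have hne : u - algebraMap F L α ≠ 0 := fun h0 =>
        h.transcendental (sub_eq_zero.1 h0 ▸ isAlgebraic_algebraMap α)
      refine not_mem_of_valuation_inv_lt_one (z := (u - algebraMap F L α)⁻¹) (inv_ne_zero hne)
        (by rwa [inv_inv])
        (ValuationSubring.mem_top _)
    · obtain ⟨g, k, hk, rfl⟩ := hV3 z hz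
      refine ⟨g.evalEval α β / k.evalEval α β, ?_⟩
      have h0 : evalPair u v k ≠ 0 := fun h0 => hk ((hV2 k).2 (by simp [h0]))
      have key : evalPair u v g / evalPair u v k -
          algebraMap F L (g.evalEval α β / k.evalEval α β) =
          evalPair u v (g - C (C (g.evalEval α β / k.evalEval α β)) * k) / evalPair u v k := by
        simp only [map_sub, map_mul, evalPair_C, aeval_C]
        field_simp
      rw [key, map_div₀, hval k hk, div_one, ← hV2]
      simp [div_mul_cancel₀ _ hk]
  refine ⟨V, hrat, hu, hv, fun W hW huW hvW => ?_⟩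
  have hWmem := evalPair_mem hW.2.1 (hW.mem_of_center huW) (hW.mem_of_center hvW)
  have hWval : ∀ k : F[X][X], k.evalEval α β ≠ 0 → W.valuation (evalPair u v k) = 1 :=
    fun k hk => le_antisymm ((W.valuation_le_one_iff _).2 (hWmem k))
      (not_lt.1 fun h' => hk (hW.evalEval_eq_zero huW hvW h'))
  apply le_antisymm
  -- If z is in W but not in V, then z⁻¹ is a fraction g/k with g(α, β) = 0 and k(α, β) ≠ 0, so z⁻¹
  -- is a nonunit of W, contradicting z ∈ W.
  · intro z hzW
    by_contra hzV
    have hinv := valuation_inv_lt_one_of_not_mem hzV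
    obtain ⟨g, k, hk, hgk⟩ := hV3 z⁻¹ ((V.valuation_le_one_iff _).1 hinv.le)
    rw [hgk, map_div₀, hval k hk, div_one, ← hV2] at hinv
    refine not_mem_of_valuation_inv_lt_one (V := W) (z := z) ?_ ?_ hzW
    · rintro rfl
      exact hzV V.zero_mem
    · rw [hgk, map_div₀, hWval k hk, div_one]
      exact hW.valuation_evalPair_lt_one huW hvW hinv
  · intro z hzV
    obtain ⟨g, k, hk, rfl⟩ := hV3 z hzV
    rw [← W.valuation_le_one_iff, map_div₀, hWval k hk, div_one, W.valuation_le_one_iff]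
    exact hWmem g

theorem evalEval_eq_zero_of_center (h : IsBilinPowModel a b c d n u v) {V : ValuationSubring L}
    (hV : IsRationalPlace F V) {α β : F} (hu : V.valuation (u - algebraMap F L α) < 1)
    (hv : V.valuation (v - algebraMap F L β) < 1) : (bilinPow a b c d n).evalEval α β = 0 :=
  hV.evalEval_eq_zero hu hv (by rw [h.eval_eq_zero, map_zero]; exact zero_lt_one)

/-- The corner (∞, ∞) is off the curve because a ≠ 0. -/
theorem right_mem_of_left_not_mem (h : IsBilinPowModel a b c d n u v) {V : ValuationSubring L}
    (hV : IsRationalPlace F V) (hu : u ∉ V) : v ∈ V := by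
  by_contra hv
  have h1 := h.inv_left.inv_right.evalEval_eq_zero_of_center hV (α := 0) (β := 0)
    (by simpa using valuation_inv_lt_one_of_not_mem hu)
    (by simpa using valuation_inv_lt_one_of_not_mem hv)
  rw [evalEval_bilinPow, zero_pow h.pos.ne'] at h1
  exact h.ha (by simpa using h1)

/-- The rational places of the curve `a x ^ n y ^ n + b x ^ n + c y ^ n + d = 0` are its affine
rational points together with the points at infinity of the two coordinate projections. -/
theorem numRationalPlaces_eq [Finite F] (h : IsBilinPowModel a b c d n u v) :
    numRationalPlaces F L =
      Nat.card {P : F × F // (bilinPow a b c d n).evalEval P.1 P.2 = 0} +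
        (Nat.card {β : F // a * β ^ n + b = 0} + Nat.card {α : F // a * α ^ n + c = 0}) := by
  have hz2 : ∀ β : F, (bilinPow c d a b n).evalEval 0 β = a * β ^ n + b := fun β => by
    rw [evalEval_bilinPow, zero_pow h.pos.ne']; ring
  have hz3 : ∀ α : F, (bilinPow b a d c n).evalEval α 0 = a * α ^ n + c := fun α => by
    rw [evalEval_bilinPow, zero_pow h.pos.ne']; ring
  have e1 : ∀ P : {P : F × F // (bilinPow a b c d n).evalEval P.1 P.2 = 0}, _ :=
    fun P => h.exists_place P.2
  have e2 : ∀ β : {β : F // a * β ^ n + b = 0}, _ :=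
    fun β => h.inv_left.exists_place ((hz2 β.1).trans β.2)
  have e3 : ∀ α : {α : F // a * α ^ n + c = 0}, _ :=
    fun α => h.inv_right.exists_place ((hz3 α.1).trans α.2)
  choose V1 r1 u1 v1 q1 using e1
  choose V2 r2 u2 v2 q2 using e2
  choose V3 r3 u3 v3 q3 using e3
  -- A pole of u or of v separates the places at infinity from the affine ones.
  have i2 : ∀ β, u ∉ V2 β := fun β =>
    not_mem_of_valuation_inv_lt_one h.left_ne_zero (by simpa using u2 β)
  have i3 : ∀ α, v ∉ V3 α := fun α =>
    not_mem_of_valuation_inv_lt_one h.right_ne_zero (by simpa using v3 α)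
  let f : {P : F × F // (bilinPow a b c d n).evalEval P.1 P.2 = 0} ⊕
      ({β : F // a * β ^ n + b = 0} ⊕ {α : F // a * α ^ n + c = 0}) →
      {V : ValuationSubring L // IsRationalPlace F V} :=
    Sum.elim (fun P => ⟨V1 P, r1 P⟩) (Sum.elim (fun β => ⟨V2 β, r2 β⟩) (fun α => ⟨V3 α, r3 α⟩))
  have hf : Function.Bijective f := by
    constructor
    · refine Function.Injective.sumElim ?_ (Function.Injective.sumElim ?_ ?_ ?_) ?_
      · intro P Q hPQ
        have hV : V1 P = V1 Q := congrArg Subtype.val hPQ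
        exact Subtype.ext (Prod.ext ((r1 P).center_unique (u1 P) (hV ▸ u1 Q))
          ((r1 P).center_unique (v1 P) (hV ▸ v1 Q)))
      · intro P Q hPQ
        have hV : V2 P = V2 Q := congrArg Subtype.val hPQ
        exact Subtype.ext ((r2 P).center_unique (v2 P) (hV ▸ v2 Q))
      · intro P Q hPQ
        have hV : V3 P = V3 Q := congrArg Subtype.val hPQ
        exact Subtype.ext ((r3 P).center_unique (u3 P) (hV ▸ u3 Q))
      · intro P Q hPQ
        have hV : V2 P = V3 Q := congrArg Subtype.val hPQ
        exact i3 Q (hV ▸ (r2 P).mem_of_center (v2 P))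
      · rintro P (Q | Q) hPQ
        · have hV : V1 P = V2 Q := congrArg Subtype.val hPQ
          exact i2 Q (hV ▸ (r1 P).mem_of_center (u1 P))
        · have hV : V1 P = V3 Q := congrArg Subtype.val hPQ
          exact i3 Q (hV ▸ (r1 P).mem_of_center (v1 P))
    · rintro ⟨V, hV⟩
      by_cases hu : u ∈ V
      · obtain ⟨α, hα⟩ := hV.2.2 u hu
        by_cases hv : v ∈ V
        · obtain ⟨β, hβ⟩ := hV.2.2 v hv
          refine ⟨Sum.inl ⟨(α, β), h.evalEval_eq_zero_of_center hV hα hβ⟩, ?_⟩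
          exact Subtype.ext (q1 _ V hV hα hβ).symm
        · have hβ : V.valuation (v⁻¹ - algebraMap F L 0) < 1 := by
            simpa using valuation_inv_lt_one_of_not_mem hv
          refine ⟨Sum.inr (Sum.inr ⟨α, ?_⟩), ?_⟩
          · rw [← hz3]
            exact h.inv_right.evalEval_eq_zero_of_center hV hα hβ
          · exact Subtype.ext (q3 _ V hV hα hβ).symm
      · obtain ⟨β, hβ⟩ := hV.2.2 v (h.right_mem_of_left_not_mem hV hu)
        have hα : V.valuation (u⁻¹ - algebraMap F L 0) < 1 := by
          simpa using valuation_inv_lt_one_of_not_mem hu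
        refine ⟨Sum.inr (Sum.inl ⟨β, ?_⟩), ?_⟩
        · rw [← hz2]
          exact h.inv_left.evalEval_eq_zero_of_center hV hα hβ
        · exact Subtype.ext (q2 _ V hV hα hβ).symm
  rw [numRationalPlaces, ← Nat.card_congr (Equiv.ofBijective f hf), Nat.card_sum, Nat.card_sum]

end IsBilinPowModel

/-- The coordinate functions generate the function field of the curve `bilinPow a b c d n = 0`. -/
theorem IsNondegenerate.isBilinPowModel {F : Type*} [Field F] {a b c d : F} {n : ℕ}
    (h : IsNondegenerate a b c d n) [IsDomain (AdjoinRoot (bilinPow a b c d n))] :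
    IsBilinPowModel a b c d n
      (algebraMap (AdjoinRoot (bilinPow a b c d n))
        (FractionRing (AdjoinRoot (bilinPow a b c d n))) (AdjoinRoot.of _ X))
      (algebraMap (AdjoinRoot (bilinPow a b c d n))
        (FractionRing (AdjoinRoot (bilinPow a b c d n))) (AdjoinRoot.root _)) := by
  have hpos : 0 < n := Nat.pos_of_ne_zero (by rintro rfl; simpa using h.hn)
  set p := bilinPow a b c d n with hp
  set u := algebraMap (AdjoinRoot p) (FractionRing (AdjoinRoot p)) (AdjoinRoot.of _ X)
  set v := algebraMap (AdjoinRoot p) (FractionRing (AdjoinRoot p)) (AdjoinRoot.root _)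
  have hev : (evalPair u v : F[X][X] →+* FractionRing (AdjoinRoot p)) =
      (algebraMap (AdjoinRoot p) (FractionRing (AdjoinRoot p))).comp (AdjoinRoot.mk p) := by
    apply Polynomial.ringHom_ext'
    · apply Polynomial.ringHom_ext'
      · ext t
        simp only [RingHom.comp_apply, evalPair_C, aeval_C]
        rfl
      · simp only [RingHom.comp_apply, evalPair_C, aeval_X]
        rfl
    · simp only [RingHom.comp_apply, evalPair_X]
      rfl
  refine { h with transcendental := ?_, eval_eq_zero := ?_, adjoin_eq_top := ?_ }
  · rw [transcendental_iff]
    intro g hg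
    rw [← evalPair_C u v, hev, RingHom.comp_apply, map_eq_zero_iff _ (IsFractionRing.injective _ _),
      AdjoinRoot.mk_eq_zero] at hg
    -- The equation has degree n > 0 in y, so it divides no nonzero polynomial in x alone.
    by_contra hg0
    have := natDegree_le_of_dvd hg (C_ne_zero.2 hg0)
    rw [natDegree_C, hp, natDegree_bilinPow h.ha hpos] at this
    omega
  · rw [hev, RingHom.comp_apply, AdjoinRoot.mk_self, map_zero]
  · rw [eq_top_iff]
    intro z _
    have hmem : ∀ g : AdjoinRoot p, algebraMap (AdjoinRoot p) (FractionRing (AdjoinRoot p)) g ∈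
        IntermediateField.adjoin F {u, v} := by
      intro g
      obtain ⟨g, rfl⟩ := AdjoinRoot.mk_surjective g
      rw [← RingHom.comp_apply, ← hev, evalPair, coe_eval₂RingHom, eval₂_eq_sum_range]
      refine sum_mem fun i _ => mul_mem ?_ (pow_mem (IntermediateField.subset_adjoin F _ (by simp)) _)
      rw [AlgHom.toRingHom_eq_coe, RingHom.coe_coe, aeval_eq_sum_range]
      exact sum_mem fun i _ => IntermediateField.smul_mem _
        (pow_mem (IntermediateField.subset_adjoin F _ (by simp)) _)
    obtain ⟨g, k, _, rfl⟩ := IsFractionRing.div_surjective (A := AdjoinRoot p) z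
    exact div_mem (hmem g) (hmem k)

/-! ### Counting points through the norm -/

/-- The affine points of the curve outside the torus lie on the coordinate axes. -/
theorem card_zeros_bilinPow {F : Type*} [Field F] [Finite F] {a b c d : F} {n : ℕ} (hn : 0 < n)
    (hd : d ≠ 0) :
    Nat.card {P : F × F // (bilinPow a b c d n).evalEval P.1 P.2 = 0} =
      numTorusPoints (bilinPow a b c d n) +
        (Nat.card {y : F // c * y ^ n + d = 0} + Nat.card {x : F // b * x ^ n + d = 0}) := by
  have h1 : ∀ y, (bilinPow a b c d n).evalEval 0 y = c * y ^ n + d := fun y => by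
    rw [evalEval_bilinPow, zero_pow hn.ne']; ring
  have h2 : ∀ x, (bilinPow a b c d n).evalEval x 0 = b * x ^ n + d := fun x => by
    rw [evalEval_bilinPow, zero_pow hn.ne']; ring
  have hx : ∀ x : F, b * x ^ n + d = 0 → x ≠ 0 := by
    rintro x hx rfl
    rw [zero_pow hn.ne', mul_zero, zero_add] at hx
    exact hd hx
  let f : {P : F × F // (bilinPow a b c d n).evalEval P.1 P.2 = 0 ∧ P.1 * P.2 ≠ 0} ⊕
      ({y : F // c * y ^ n + d = 0} ⊕ {x : F // b * x ^ n + d = 0}) →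
      {P : F × F // (bilinPow a b c d n).evalEval P.1 P.2 = 0} :=
    Sum.elim (fun P => ⟨P.1, P.2.1⟩) (Sum.elim (fun y => ⟨(0, y.1), (h1 _).trans y.2⟩)
      (fun x => ⟨(x.1, 0), (h2 _).trans x.2⟩))
  have hf : Function.Bijective f := by
    constructor
    · refine Function.Injective.sumElim ?_ (Function.Injective.sumElim ?_ ?_ ?_) ?_
      · exact fun P Q h => Subtype.ext (congrArg (fun R => R.1) h)
      · exact fun P Q h => Subtype.ext (congrArg (fun R => R.1.2) h)
      · exact fun P Q h => Subtype.ext (congrArg (fun R => R.1.1) h)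
      · exact fun P Q h => hx _ Q.2 (congrArg (fun R => R.1.1) h).symm
      · rintro ⟨P, _, hP⟩ (Q | Q) h
        · exact left_ne_zero_of_mul hP (congrArg (fun R => R.1.1) h)
        · exact right_ne_zero_of_mul hP (congrArg (fun R => R.1.2) h)
    · rintro ⟨⟨x, y⟩, hP⟩
      by_cases hx0 : x = 0
      · subst hx0
        exact ⟨Sum.inr (Sum.inl ⟨y, (h1 y).symm.trans hP⟩), rfl⟩
      · by_cases hy0 : y = 0
        · subst hy0
          exact ⟨Sum.inr (Sum.inr ⟨x, (h2 x).symm.trans hP⟩), rfl⟩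
        · exact ⟨Sum.inl ⟨(x, y), hP, mul_ne_zero hx0 hy0⟩, rfl⟩
  rw [← Nat.card_congr (Equiv.ofBijective f hf), Nat.card_sum, Nat.card_sum, numTorusPoints]

theorem numTorusPoints_eq_card_units {K : Type*} [Field K] (f : K[X][X]) :
    numTorusPoints f = Nat.card {P : Kˣ × Kˣ // f.evalEval (P.1 : K) (P.2 : K) = 0} := by
  refine (Nat.card_congr (Equiv.ofBijective (fun P => ⟨((P.1.1 : K), (P.1.2 : K)), P.2,
    mul_ne_zero P.1.1.ne_zero P.1.2.ne_zero⟩) ⟨?_, ?_⟩)).symm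
  · intro P Q h
    exact Subtype.ext (Prod.ext (Units.ext (congrArg (fun R => R.1.1) h))
      (Units.ext (congrArg (fun R => R.1.2) h)))
  · rintro ⟨⟨x, y⟩, h, hxy⟩
    exact ⟨⟨(Units.mk0 x (left_ne_zero_of_mul hxy), Units.mk0 y (right_ne_zero_of_mul hxy)), h⟩,
      rfl⟩

/-- A surjective homomorphism of finite groups multiplies the size of a preimage by the order of
its kernel. -/
theorem MonoidHom.card_preimage_mul_card {G H : Type*} [Group G] [Group H] [Finite G] [Finite H]
    {f : G →* H} (hf : Function.Surjective f) (p : H → Prop) :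
    Nat.card {g : G // p (f g)} * Nat.card H = Nat.card {h : H // p h} * Nat.card G := by
  have key : ∀ p : H → Prop, Nat.card {g : G // p (f g)} = Nat.card {h : H // p h} *
      Nat.card f.ker := by
    intro p
    rw [← Nat.card_prod]
    refine Nat.card_congr ?_
    refine (Equiv.sigmaFiberEquiv (fun g : {g : G // p (f g)} =>
      (⟨f g.1, g.2⟩ : {h : H // p h}))).symm.trans ((Equiv.sigmaCongrRight fun h => ?_).trans
        (Equiv.sigmaEquivProd _ _))
    refine Equiv.trans ?_ (fiberEquivKerOfSurjective hf h.1)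
    exact
      { toFun := fun g => ⟨g.1.1, congrArg Subtype.val g.2⟩
        invFun := fun g => ⟨⟨g.1, by
          have hg : f g.1 = h.1 := g.2
          rw [hg]; exact h.2⟩, Subtype.ext g.2⟩
        left_inv := fun _ => rfl
        right_inv := fun _ => rfl }
  have h1 := key p
  -- The always-true predicate gives the order of the kernel.
  have h2 := key fun _ => True
  simp only [Nat.card_congr (Equiv.subtypeUnivEquiv (p := fun _ : G => True) fun _ => trivial),
    Nat.card_congr (Equiv.subtypeUnivEquiv (p := fun _ : H => True) fun _ => trivial)] at h2
  rw [h1, h2]; ring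

section Norm

variable {F K : Type*} [Field F] [Finite F] [Field K] [Finite K] [Algebra K F]

/-- The bridge between the two fields: the norm to K is x ↦ x^M. -/
theorem algebraMap_norm_pow {M m : ℕ} (hM : Nat.card F - 1 = M * (Nat.card K - 1)) (x : F) :
    algebraMap K F (Algebra.norm K x ^ m) = x ^ (M * m) := by
  have hpos : 0 < Nat.card K - 1 := Nat.sub_pos_of_lt Finite.one_lt_card
  rw [map_pow, FiniteField.algebraMap_norm_eq_pow, hM, Nat.mul_div_cancel _ hpos, pow_mul]

theorem numTorusPoints_bilinPow {M m : ℕ} (hM : Nat.card F - 1 = M * (Nat.card K - 1))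
    (a b c d : K) :
    numTorusPoints (bilinPow (algebraMap K F a) (algebraMap K F b) (algebraMap K F c)
      (algebraMap K F d) (M * m)) = M ^ 2 * numTorusPoints (bilinPow a b c d m) := by
  have hpos : 0 < Nat.card K - 1 := Nat.sub_pos_of_lt Finite.one_lt_card
  let N : Fˣ →* Kˣ := Units.map (Algebra.norm K)
  have hN : Function.Surjective N := FiniteField.unitsMap_norm_surjective K F
  have hval : ∀ x : Fˣ, ((N x : Kˣ) : K) = Algebra.norm K (x : F) := fun x => rfl
  have h := MonoidHom.card_preimage_mul_card (f := N.prodMap N)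
    (Function.Surjective.prodMap hN hN)
    (fun P => (bilinPow a b c d m).evalEval (P.1 : K) (P.2 : K) = 0)
  have hiff : ∀ P : Fˣ × Fˣ, (bilinPow a b c d m).evalEval ((N.prodMap N P).1 : K)
      ((N.prodMap N P).2 : K) = 0 ↔ (bilinPow (algebraMap K F a) (algebraMap K F b)
        (algebraMap K F c) (algebraMap K F d) (M * m)).evalEval (P.1 : F) (P.2 : F) = 0 := by
    intro P
    rw [evalEval_bilinPow, evalEval_bilinPow, ← algebraMap_norm_pow hM, ← algebraMap_norm_pow hM,
      ← map_mul, ← map_mul, ← map_mul, ← map_mul, ← map_add, ← map_add, ← map_add,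
      map_eq_zero_iff _ (algebraMap K F).injective]
    rfl
  rw [Nat.card_congr (Equiv.subtypeEquivRight hiff), ← numTorusPoints_eq_card_units,
    ← numTorusPoints_eq_card_units, Nat.card_prod, Nat.card_prod, Nat.card_units, Nat.card_units,
    hM] at h
  have h2 : 0 < (Nat.card K - 1) * (Nat.card K - 1) := Nat.mul_pos hpos hpos
  refine Nat.eq_of_mul_eq_mul_right h2 (h.trans ?_)
  ring

/-- A nonempty fibre is a coset of the m-torsion of the cyclic group Kˣ, which has order m since m
divides |Kˣ|. -/
theorem card_units_pow_eq {m : ℕ} (hm : m ∣ Nat.card K - 1) {d : K} (hd : d ≠ 0) :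
    Nat.card {s : Kˣ // (s : K) ^ m = d} = powerIndicator m d * m := by
  have hpos : 0 < Nat.card K - 1 := Nat.sub_pos_of_lt Finite.one_lt_card
  have hm0 : m ≠ 0 := by
    rintro rfl
    have := Nat.eq_zero_of_zero_dvd hm
    omega
  unfold powerIndicator
  split_ifs with h
  · obtain ⟨t, rfl⟩ := h
    have ht : t ≠ 0 := by
      rintro rfl
      exact hd (zero_pow hm0)
    have hiff : ∀ s : Kˣ, (s : K) ^ m = t ^ m ↔ s ∈
        (powMonoidHom m : Kˣ →* Kˣ) ⁻¹' {powMonoidHom m (Units.mk0 t ht)} := by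
      intro s
      rw [Set.mem_preimage, Set.mem_singleton_iff, powMonoidHom_apply, powMonoidHom_apply,
        Units.ext_iff]
      simp
    rw [Nat.card_congr (Equiv.subtypeEquivRight hiff)]
    refine (Nat.card_congr ((powMonoidHom m : Kˣ →* Kˣ).fiberEquivKer (Units.mk0 t ht))).trans ?_
    rw [IsCyclic.card_powMonoidHom_ker, Nat.card_units, Nat.gcd_eq_right hm, one_mul]
  · have : IsEmpty {s : Kˣ // (s : K) ^ m = d} := ⟨fun s => h ⟨s.1, s.2⟩⟩
    rw [Nat.card_of_isEmpty, zero_mul]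

theorem card_pow_eq {M m : ℕ} (hM : Nat.card F - 1 = M * (Nat.card K - 1))
    (hm : m ∣ Nat.card K - 1) {d : K} (hd : d ≠ 0) :
    Nat.card {t : F // t ^ (M * m) = algebraMap K F d} = powerIndicator m d * (M * m) := by
  have hpos : 0 < Nat.card K - 1 := Nat.sub_pos_of_lt Finite.one_lt_card
  have hpos' : 0 < Nat.card F - 1 := Nat.sub_pos_of_lt Finite.one_lt_card
  have hMm : M * m ≠ 0 := by
    rintro h
    obtain ⟨k, hk⟩ := hm
    rw [hM, hk, ← mul_assoc, h, zero_mul] at hpos'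
    exact lt_irrefl _ hpos'
  let N : Fˣ →* Kˣ := Units.map (Algebra.norm K)
  have hN : Function.Surjective N := FiniteField.unitsMap_norm_surjective K F
  have h := MonoidHom.card_preimage_mul_card hN (fun s => (s : K) ^ m = d)
  rw [card_units_pow_eq hm hd, Nat.card_units, Nat.card_units, hM] at h
  have e : Nat.card {g : Fˣ // ((N g : Kˣ) : K) ^ m = d} =
      Nat.card {t : F // t ^ (M * m) = algebraMap K F d} := by
    have hiff : ∀ x : Fˣ, ((N x : Kˣ) : K) ^ m = d ↔ (x : F) ^ (M * m) = algebraMap K F d := by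
      intro x
      rw [← algebraMap_norm_pow hM, (algebraMap K F).injective.eq_iff]
      rfl
    refine Nat.card_congr (Equiv.ofBijective
      (fun x => ⟨(x.1 : F), (hiff x.1).1 x.2⟩) ⟨?_, ?_⟩)
    · exact fun x y hxy => Subtype.ext (Units.ext (congrArg Subtype.val hxy))
    · rintro ⟨t, ht⟩
      have ht0 : t ≠ 0 := by
        rintro rfl
        rw [zero_pow hMm, eq_comm, map_eq_zero] at ht
        exact hd ht
      exact ⟨⟨Units.mk0 t ht0, (hiff _).2 ht⟩, rfl⟩
  rw [e] at h
  refine Nat.eq_of_mul_eq_mul_right hpos (h.trans ?_)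
  ring

theorem card_mul_pow_add_eq_zero {M m : ℕ} (hM : Nat.card F - 1 = M * (Nat.card K - 1))
    (hm : m ∣ Nat.card K - 1) {a b : K} (ha : a ≠ 0) (hb : b ≠ 0) :
    Nat.card {t : F // algebraMap K F a * t ^ (M * m) + algebraMap K F b = 0} =
      powerIndicator m (-b / a) * (M * m) := by
  rw [← card_pow_eq hM hm (div_ne_zero (neg_ne_zero.2 hb) ha)]
  refine Nat.card_congr (Equiv.subtypeEquivRight fun t => ?_)
  have ha' : algebraMap K F a ≠ 0 := by simpa using ha
  rw [map_div₀, map_neg, eq_div_iff ha', eq_neg_iff_add_eq_zero, mul_comm]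

end Norm

/-! ### Assembling the formula -/

theorem powerIndicator_inv {K : Type*} [Field K] (k : ℕ) (d : K) :
    powerIndicator k d⁻¹ = powerIndicator k d := by
  have h : (∃ t : K, t ^ k = d⁻¹) ↔ ∃ t : K, t ^ k = d := by
    constructor
    · rintro ⟨t, ht⟩
      exact ⟨t⁻¹, by rw [inv_pow, ht, inv_inv]⟩
    · rintro ⟨t, rfl⟩
      exact ⟨t⁻¹, inv_pow _ _⟩
  unfold powerIndicator
  split_ifs with h1 h2 h2
  · rfl
  · exact absurd (h.1 h1) h2
  · exact absurd (h.2 h2) h1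
  · rfl

/-- The torus and the lines x = 0, y = 0, x = ∞, y = ∞, in this order. -/
theorem numRationalPoints_bilinPow {F : Type*} [Field F] [Finite F] {a b c d : F} {n : ℕ}
    (h : IsNondegenerate a b c d n) (hf : Irreducible (bilinPow a b c d n)) :
    numRationalPoints _ hf = numTorusPoints (bilinPow a b c d n) +
        (Nat.card {y : F // c * y ^ n + d = 0} + Nat.card {x : F // b * x ^ n + d = 0}) +
      (Nat.card {y : F // a * y ^ n + b = 0} + Nat.card {x : F // a * x ^ n + c = 0}) := by
  have : IsDomain (AdjoinRoot (bilinPow a b c d n)) := coordinateRing_isDomain hf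
  have hpos : 0 < n := Nat.pos_of_ne_zero (by rintro rfl; simpa using h.hn)
  rw [← card_zeros_bilinPow hpos h.hd]
  exact h.isBilinPowModel.numRationalPlaces_eq

theorem mainTheorem8 {F K : Type*} [Field F] [Finite F] [Field K] [Finite K] [Algebra K F]
    (p h r n : ℕ) (hp : p.Prime) (hr : 0 < r) (hrh : r < h) (h2r : 2 * r ∣ h)
    (hF : Nat.card F = p ^ h) (hK : Nat.card K = p ^ (2 * r))
    (hn : n = (p ^ h - 1) / (p ^ r + 1))
    (a b c : K) (ha : a ≠ 0) (hb : b ≠ 0) (hc : c ≠ 0) (hcab : c ≠ -a / b)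
    (h1 : a * c ^ (p ^ r) = -b) (h2 : a ^ (p ^ r + 1) = 1) (h3 : a * b ^ (p ^ r) = -c) :
    ∃ hf : Irreducible
        (genFermat (algebraMap K F a) (algebraMap K F b) (algebraMap K F c) n n),
      numRationalPoints _ hf =
        ((p ^ h - 1) / (p ^ (2 * r) - 1)) ^ 2 *
            numTorusPoints (genFermat a b c (p ^ r - 1) (p ^ r - 1)) +
          (powerIndicator (p ^ r - 1) c + powerIndicator (p ^ r - 1) b +
            powerIndicator (p ^ r - 1) (-c / a) + powerIndicator (p ^ r - 1) (-b / a)) * n := by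
  have hQ : 1 < p ^ r := Nat.one_lt_pow hr.ne' hp.one_lt
  have hfac : p ^ (2 * r) - 1 = (p ^ r - 1) * (p ^ r + 1) := by
    rw [mul_comm 2 r, pow_mul, ← one_pow 2, Nat.sq_sub_sq, one_pow, mul_comm]
  have hm : p ^ r - 1 ∣ Nat.card K - 1 := by rw [hK, hfac]; exact Dvd.intro _ rfl
  have hdvd : p ^ (2 * r) - 1 ∣ p ^ h - 1 := by
    obtain ⟨k, rfl⟩ := h2r
    simpa only [one_pow, pow_mul] using Nat.sub_dvd_pow_sub_pow (p ^ (2 * r)) 1 k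
  obtain ⟨M, hM⟩ := hdvd
  have hK1 : 0 < p ^ (2 * r) - 1 := by
    rw [hfac]
    exact Nat.mul_pos (Nat.sub_pos_of_lt hQ) (Nat.succ_pos _)
  have hM' : Nat.card F - 1 = M * (Nat.card K - 1) := by rw [hF, hK, hM, mul_comm]
  have hnM : n = M * (p ^ r - 1) := by
    rw [hn, hM, hfac, mul_right_comm, Nat.mul_div_cancel _ (Nat.succ_pos _), mul_comm]
  -- From n (p^r + 1) + 1 = q, which is 0 in F.
  have hnF : (n : F) ≠ 0 := by
    intro h0
    have hq : n * (p ^ r + 1) + 1 = Nat.card F := by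
      rw [hnM, mul_assoc, ← hfac, mul_comm M, ← hM, hF]
      exact Nat.sub_add_cancel (Nat.one_le_pow _ _ hp.pos)
    have hq' := congrArg (Nat.cast (R := F)) hq
    have : Fintype F := Fintype.ofFinite F
    rw [Nat.card_eq_fintype_card, FiniteField.cast_card_eq_zero] at hq'
    simp [h0] at hq'
  have hinj := (algebraMap K F).injective
  have hone : (-1 : F) = algebraMap K F (-1) := by simp
  have hnd : IsNondegenerate (algebraMap K F a) (algebraMap K F b) (algebraMap K F c)
      (algebraMap K F (-1)) n :=
    { ha := by simpa using ha
      hb := by simpa using hb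
      hc := by simpa using hc
      hd := by simp
      -- With d = -1, the condition ad ≠ bc is c ≠ -a/b.
      hdet := by
        rw [← map_mul, ← map_mul, hinj.ne_iff]
        intro h0
        apply hcab
        rw [eq_div_iff hb]
        linear_combination -h0
      hn := hnF }
  rw [hM, Nat.mul_div_cancel_left _ hK1, genFermat_eq_bilinPow, genFermat_eq_bilinPow, hone]
  have hf := irreducible_bilinPow hnd.ha hnd.hb hnd.hd hnd.hdet hnF
  refine ⟨hf, ?_⟩
  have hneg : (-1 : K) ≠ 0 := neg_ne_zero.2 one_ne_zero
  rw [numRationalPoints_bilinPow hnd hf]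
  subst hnM
  -- The axes produce δ(1/c) and δ(1/b), which equal δ(c) and δ(b).
  rw [numTorusPoints_bilinPow hM', card_mul_pow_add_eq_zero hM' hm hc hneg,
    card_mul_pow_add_eq_zero hM' hm hb hneg, card_mul_pow_add_eq_zero hM' hm ha hb,
    card_mul_pow_add_eq_zero hM' hm ha hc, neg_neg, one_div, one_div, powerIndicator_inv,
    powerIndicator_inv]
  ring
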